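/- Notation. $2^\omega$ is the Cantor space, and $\mathcal M$ is the ideal of its meager subsets. $\operatorname{cov}(\mathcal M)$ is the least size of a family of meager sets whose union is $2^\omega$. For $x,y\in\omega^\omega$, $x\le^* y$ means $x(n)\le y(n)$ for all but finitely many $n$. A set $D\subseteq\omega^\omega$ is dominating if every $x\in\omega^\omega$ satisfies $x\le^* y$ for some $y\in D$, and $\mathfrak d$ is the least size of a dominating set. $\omega^{\uparrow\omega}$ is the set of (strictly) increasing functions in $\omega^\omega$. For $\sigma\in(2^{<\omega})^\omega$ let $[\sigma]_\infty=\{x\in2^\omega:\sigma(n)\subseteq x\text{ for infinitely many }n\}$. For $f\in\omega^{\uparrow\omega}$, the Yorioka ideal $\mathcal I_f$ consists of all $A\subseteq 2^\omega$ such that $A\subseteq[\sigma]_\infty$ for some $\sigma\in(2^{<\omega})^\omega$ satisfying: for every $k<\omega$, $f(i^k)\le|\sigma(i)|$ for all but finitely many $i$. $\operatorname{cof}(\mathcal I_f)$ is the least size of a subfamily of $\mathcal I_f$ that is cofinal in $\langle\mathcal I_f,\subseteq\rangle$, and $\mathrm{supcof}=\sup\{\operatorname{cof}(\mathcal I_f):f\in\omega^{\uparrow\omega}\}$.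 For an ordinal $\delta$, $\mathbf{DS}(\delta)$ is the statement: there are a sequence $\langle f_\alpha:\alpha<\delta\rangle$ in $\omega^{\uparrow\omega}$ whose range is dominating, and sets $A_\alpha\subseteq 2^\omega$ ($\alpha<\delta$), such that for every $\alpha<\delta$, $A_\alpha\in\mathcal I_{f_\alpha}$ and $\bigcap_{\xi<\alpha}A_\xi\notin\mathcal I_{f_\alpha}$ (the empty intersection being $2^\omega$). Lemma. Assume $\operatorname{cov}(\mathcal M)=\mathfrak d$. Then: (1) $\mathbf{DS}(\mathfrak d)$ holds. (2) For every dominating family $D\subseteq\omega^{\uparrow\omega}$ and every set $I$ with $\mathrm{supcof}\le|I|$ there are a sequence $\langle f_\alpha:\alpha<\mathfrak d\rangle$ of members of $D$ whose range is dominating and sets $A^\alpha_i\subseteq 2^\omega$ ($\alpha<\mathfrak d$, $i\in I$) such that for every $\alpha<\mathfrak d$: $\{A^\alpha_i:i\in I\}$ is a cofinal subfamily of $\langle\mathcal I_{f_\alpha},\subseteq\rangle$, and $\bigcap_{\xi<\alpha}A^\xi_{z(\xi)}\notin\mathcal I_{f_\alpha}$ for every $z\in I^\alpha$. -/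

import Mathlib

namespace DomSys

open Cardinal

/-- The Cantor space `2^ω`, with the product topology. -/
abbrev Cantor : Type := ℕ → Bool

/-- `x ≤* y`: `x n ≤ y n` for all but finitely many `n`. -/
def EvLE (x y : ℕ → ℕ) : Prop := ∀ᶠ n in Filter.atTop, x n ≤ y n

/-- Dominating families in `ω^ω`. -/
def IsDominating (D : Set (ℕ → ℕ)) : Prop := ∀ x : ℕ → ℕ, ∃ y ∈ D, EvLE x y

/-- The dominating number `𝔡`. -/
noncomputable def dominatingNumber : Cardinal.{0} :=
  sInf {κ | ∃ D : Set (ℕ → ℕ), IsDominating D ∧ #D = κ}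

/-- The set `ω^{↑ω}` of increasing functions. -/
def Increasing : Set (ℕ → ℕ) := {f | StrictMono f}

/-- The covering number of a family `J` of subsets of `X`. -/
noncomputable def cov {X : Type} (J : Set (Set X)) : Cardinal.{0} :=
  sInf {κ | ∃ F : Set (Set X), F ⊆ J ∧ ⋃₀ F = Set.univ ∧ #F = κ}

/-- The cofinality of a family `J` of subsets of `X`, ordered by inclusion. -/
noncomputable def cof {X : Type} (J : Set (Set X)) : Cardinal.{0} :=
  sInf {κ | ∃ F : Set (Set X), F ⊆ J ∧ (∀ A ∈ J, ∃ B ∈ F, A ⊆ B) ∧ #F = κ}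

/-- The ideal of meager subsets of the Cantor space. -/
def meagerIdeal : Set (Set Cantor) := {A | IsMeagre A}

/-- The basic clopen set `[s]` of all `x` extending the finite binary sequence `s`. -/
def cylinder (s : List Bool) : Set Cantor := {x | ∀ i : Fin s.length, x i = s.get i}

/-- The height function of a sequence of finite binary sequences. -/
def height (σ : ℕ → List Bool) : ℕ → ℕ := fun n => (σ n).length

/-- `[σ]_∞`: the set of all `x` extending `σ n` for infinitely many `n`. -/
def infCylinder (σ : ℕ → List Bool) : Set Cantor :=
  {x | ∃ᶠ n in Filter.atTop, x ∈ cylinder (σ n)}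

/-- `x ≪ y`: for every `k`, `x (i ^ k) ≤ y i` for all but finitely many `i`. -/
def MuchLE (x y : ℕ → ℕ) : Prop := ∀ k : ℕ, ∀ᶠ i in Filter.atTop, x (i ^ k) ≤ y i

/-- The Yorioka ideal `𝓘_f`. -/
def yorioka (f : ℕ → ℕ) : Set (Set Cantor) :=
  {A | ∃ σ : ℕ → List Bool, MuchLE f (height σ) ∧ A ⊆ infCylinder σ}

/-- `supcof`, the supremum of `cof(𝓘_f)` over all increasing `f`. -/
noncomputable def supcof : Cardinal.{0} := ⨆ f : Increasing, cof (yorioka f)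

/-- `f = ⟨f_α : α < δ⟩` forms a dominating family of increasing functions. -/
def IsDominatingSeq (δ : Ordinal.{0}) (f : Set.Iio δ → ℕ → ℕ) : Prop :=
  (∀ α, f α ∈ Increasing) ∧ IsDominating (Set.range f)

/-- `(f, A)` is a `DS`-pair of length `δ`. -/
structure IsDSPair (δ : Ordinal.{0}) (f : Set.Iio δ → ℕ → ℕ)
    (A : Set.Iio δ → Set Cantor) : Prop where
  dominating : IsDominatingSeq δ f
  mem : ∀ α, A α ∈ yorioka (f α)
  inter_notMem : ∀ α, (⋂ ξ ∈ Set.Iio α, A ξ) ∉ yorioka (f α)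

/-- The principle `DS(δ)`. -/
def DS (δ : Ordinal.{0}) : Prop :=
  ∃ (f : Set.Iio δ → ℕ → ℕ) (A : Set.Iio δ → Set Cantor), IsDSPair δ f A

/-- `⟨A^α_i : i ∈ I⟩`, `α < δ`, is an `f`-dominating system on `I`, where
`f = ⟨f_α : α < δ⟩` forms a dominating family of increasing functions. -/
structure IsDominatingSystem {I : Type*} (δ : Ordinal.{0}) (f : Set.Iio δ → ℕ → ℕ)
    (A : Set.Iio δ → I → Set Cantor) : Prop where
  dominating : IsDominatingSeq δ f
  mem : ∀ α i, A α i ∈ yorioka (f α)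
  cofinal : ∀ α, ∀ B ∈ yorioka (f α), ∃ i, B ⊆ A α i
  inter_notMem : ∀ α, ∀ z : Set.Iio α → I,
    (⋂ ξ : Set.Iio α, A ξ (z ξ)) ∉ yorioka (f α)

end DomSys

/-!
Each increasing `h` gets one fixed comeager member `denseSet h` of `𝓘_h`, namely
`[padded h]_∞`, where `padded h` lists all finite binary sequences, each one lengthened by enough
zeros. Adding `denseSet h` to the members of a cofinal family of `𝓘_h` keeps it cofinal in `𝓘_h`, so
both parts follow once the functions `f_α` are such that `⋂_{ξ<α} denseSet f_ξ ∉ 𝓘_{f_α}`; the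
choice of indices `z` then no longer matters.

By `iInter_denseSet_notMem_yorioka` it suffices that, for every `ξ < α`, `f_α` exceeds infinitely
often a function `growth f_ξ` which bounds the lengths in `padded f_ξ`. Indeed, let `τ` witness
membership in `𝓘_{f_α}`. The finite sequences that are incompatible with finitely many given `τ i`, and short
compared with the remaining ones, form a countable forcing notion. At an `n` where
`growth f_ξ n ≤ f_α n`, such a sequence can be continued by diagonalizing against all `τ i`, `i ≤ n`,
and then padded with zeros to a term of `padded f_ξ`, while still being short compared with the
`τ i`, `i > n`. Hence meeting the relevant dense sets takes a generic sequence for fewer than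
`cov(𝓜)` countable collections of dense sets, which exists by `exists_generic`.

Finally, as fewer than `𝔡` functions are never dominating, a recursion of length `𝔡` produces
`f_α ∈ D` above the `α`-th member of a dominating family and not bounded by any `growth f_ξ`, `ξ < α`
(`exists_mem_not_evLE`).
-/

namespace DomSys

open Cardinal Filter

/-! ### Generic sequences and `cov(𝓜)` -/

section Generic

variable {S : Type}

open Classical in
/-- The sequence of conditions read off from a binary sequence `x`: starting from `s₀`, at step `j`
move to `e j` if `x j` says so and `e j` is a legal successor, and stay put otherwise. -/
noncomputable def path (r : S → S → Prop) (e : ℕ → S) (s₀ : S) (x : Cantor) : ℕ → S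
  | 0 => s₀
  | j + 1 => if x j = true ∧ r (path r e s₀ x j) (e j) then e j else path r e s₀ x j

variable {r : S → S → Prop} {e : ℕ → S} {s₀ : S}

lemma path_congr {x y : Cantor} {j : ℕ} (h : ∀ i < j, x i = y i) :
    path r e s₀ x j = path r e s₀ y j := by
  induction j with
  | zero => rfl
  | succ j ih => rw [path, path, ih fun i hi => h i (by omega), h j (by omega)]

lemma path_of_false {x : Cantor} {n j : ℕ} (hnj : n ≤ j) (h : ∀ i, n ≤ i → i < j → x i = false) :
    path r e s₀ x j = path r e s₀ x n := by
  induction j, hnj using Nat.le_induction with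
  | base => rfl
  | succ j hj ih =>
    simp only [path, h j hj (by omega), Bool.false_eq_true, false_and, if_false]
    exact ih fun i h1 h2 => h i h1 (by omega)

lemma isOpen_setOf_path_mem (D : Set S) : IsOpen {x | ∃ j, path r e s₀ x j ∈ D} := by
  rw [isOpen_iff_mem_nhds]
  rintro x ⟨j, hj⟩
  filter_upwards [(PiNat.isOpen_cylinder (fun _ => Bool) x j).mem_nhds
    (PiNat.self_mem_cylinder x j)] with y hy
  exact ⟨j, by rwa [path_congr hy]⟩

lemma dense_setOf_path_mem (he : ∀ d n, ∃ j, n ≤ j ∧ e j = d) {D : Set S}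
    (hD : ∀ s, ∃ d ∈ D, r s d) : Dense {x | ∃ j, path r e s₀ x j ∈ D} := by
  rw [(PiNat.isTopologicalBasis_cylinders (fun _ => Bool)).dense_iff]
  rintro _ ⟨x, n, rfl⟩ -
  obtain ⟨d, hdD, hd⟩ := hD (path r e s₀ x n)
  obtain ⟨j, hnj, rfl⟩ := he d n
  set y : Cantor := fun i => if i < n then x i else decide (i = j) with hy
  have hyx : ∀ i < n, y i = x i := fun i hi => by simp [hy, hi]
  refine ⟨y, hyx, j + 1, ?_⟩
  have h1 : path r e s₀ y j = path r e s₀ x n := by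
    rw [path_of_false hnj fun i h1 h2 => by simp [hy, h1.not_gt, h2.ne], path_congr hyx]
  have h2 : y j = true := by simp [hy, hnj.not_gt]
  simpa [path, h1, h2, hd] using hdD

/-- Martin's axiom for countable posets, for fewer than `cov(𝓜)` countable collections of dense
sets. The relation `r s d` reads "`d` is stronger than `s`". -/
lemma exists_generic [Countable S] (r : S → S → Prop) (hr : ∀ s, r s s) (s₀ : S) {ι : Type}
    (hι : #ι < cov meagerIdeal) (D : ι → ℕ → Set S) (hD : ∀ i N s, ∃ d ∈ D i N, r s d) :
    ∃ s : ℕ → S, (∀ j, r (s j) (s (j + 1))) ∧ ∀ i N, ∃ j, s j ∈ D i N := by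
  have : Nonempty S := ⟨s₀⟩
  obtain ⟨e₀, he₀⟩ := exists_surjective_nat S
  -- The conditions are enumerated with infinite repetition.
  let e : ℕ → S := fun j => e₀ j.unpair.2
  have he : ∀ d n, ∃ j, n ≤ j ∧ e j = d := fun d n => by
    obtain ⟨k, rfl⟩ := he₀ d
    exact ⟨Nat.pair n k, Nat.left_le_pair n k, by simp [e]⟩
  let G : ι → Set Cantor := fun i => {x | ∀ N, ∃ j, path r e s₀ x j ∈ D i N}
  have hG : ∀ i, (G i)ᶜ ∈ meagerIdeal := fun i => by
    change (G i)ᶜᶜ ∈ residual Cantor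
    rw [compl_compl]
    exact eventually_countable_forall.2 fun N =>
      residual_of_dense_open (isOpen_setOf_path_mem _) (dense_setOf_path_mem he (hD i N))
  have hne : ⋃₀ Set.range (fun i => (G i)ᶜ) ≠ Set.univ := fun h => by
    refine hι.not_ge (le_trans (csInf_le' ⟨_, ?_, h, rfl⟩) mk_range_le)
    rintro _ ⟨i, rfl⟩
    exact hG i
  obtain ⟨x, hx⟩ := (Set.ne_univ_iff_exists_notMem _).1 hne
  simp only [Set.sUnion_range, Set.mem_iUnion, Set.mem_compl_iff, not_exists, not_not] at hx
  refine ⟨path r e s₀ x, fun j => ?_, hx⟩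
  rw [path]
  split_ifs with h
  exacts [h.2, hr _]

end Generic

/-! ### Cylinders -/

lemma mem_cylinder_iff {s : List Bool} {x : Cantor} :
    x ∈ cylinder s ↔ ∀ (i : ℕ) (hi : i < s.length), x i = s[i] :=
  ⟨fun h i hi => h ⟨i, hi⟩, fun h i => h i i.2⟩

lemma cylinder_subset_of_prefix {s t : List Bool} (h : s <+: t) : cylinder t ⊆ cylinder s := by
  intro x hx
  rw [mem_cylinder_iff] at hx ⊢
  intro i hi
  rw [hx i (hi.trans_le h.length_le), h.getElem hi]

lemma exists_mem_cylinder {s : ℕ → List Bool} (h : ∀ j, s j <+: s (j + 1))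
    (hs : ∀ N, ∃ j, N ≤ (s j).length) : ∃ x : Cantor, ∀ j, x ∈ cylinder (s j) := by
  have hmono : ∀ {i j}, i ≤ j → s i <+: s j := fun {i j} hij => by
    induction j, hij using Nat.le_induction with
    | base => exact List.prefix_rfl
    | succ j _ ih => exact ih.trans (h j)
  choose J hJ using fun p => hs (p + 1)
  refine ⟨fun p => (s (J p))[p]'(hJ p), fun j => mem_cylinder_iff.2 fun p hp => ?_⟩
  rcases le_total j (J p) with hj | hj
  · exact ((hmono hj).getElem hp).symm
  · exact (hmono hj).getElem _

/-- Diagonalization: a finite binary sequence `s` extends to one which is incompatible with all of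
`τ m, …, τ n`, provided these are long enough to leave a free position for each of them. -/
lemma exists_prefix_disjoint (τ : ℕ → List Bool) (s : List Bool) {m n : ℕ}
    (h : ∀ i, m ≤ i → s.length + (i - m) + 1 ≤ (τ i).length) :
    ∃ u, s <+: u ∧ u.length = s.length + (n + 1 - m) ∧
      ∀ i, m ≤ i → i ≤ n → Disjoint (cylinder u) (cylinder (τ i)) := by
  refine ⟨s ++ List.ofFn fun j : Fin (n + 1 - m) => !(τ (m + j)).getD (s.length + j) false,
    List.prefix_append _ _, by simp, fun i h1 h2 => Set.disjoint_left.2 fun x hx hxi => ?_⟩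
  rw [mem_cylinder_iff] at hx hxi
  have hi := h i h1
  have e1 := hx (s.length + (i - m)) (by simp; omega)
  have e2 := hxi (s.length + (i - m)) (by omega)
  rw [e2, List.getElem_append_right (by omega)] at e1
  simp [show m + (i - m) = i by omega, show s.length + (i - m) < (τ i).length by omega] at e1

/-! ### Yorioka ideals -/

lemma yorioka_mono {f : ℕ → ℕ} {A B : Set Cantor} (h : A ⊆ B) (hB : B ∈ yorioka f) :
    A ∈ yorioka f :=
  let ⟨σ, h1, h2⟩ := hB
  ⟨σ, h1, h.trans h2⟩

lemma union_mem_yorioka {f : ℕ → ℕ} (hf : Monotone f) {A B : Set Cantor} (hA : A ∈ yorioka f)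
    (hB : B ∈ yorioka f) : A ∪ B ∈ yorioka f := by
  obtain ⟨σ, hσ, hA⟩ := hA
  obtain ⟨τ, hτ, hB⟩ := hB
  refine ⟨fun j => if j % 2 = 0 then σ (j / 2) else τ (j / 2), fun k => ?_, ?_⟩
  · have hdiv : Tendsto (fun j : ℕ => j / 2) atTop atTop :=
      Nat.tendsto_div_const_atTop (by norm_num)
    filter_upwards [hdiv.eventually (hσ (k + 1)), hdiv.eventually (hτ (k + 1)),
      hdiv.eventually_ge_atTop (3 ^ k), hdiv.eventually_ge_atTop 1] with j h1 h2 h3 h4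
    have hj : f (j ^ k) ≤ f ((j / 2) ^ (k + 1)) := by
      apply hf
      calc j ^ k ≤ (3 * (j / 2)) ^ k := Nat.pow_le_pow_left (by omega) k
        _ = 3 ^ k * (j / 2) ^ k := mul_pow _ _ _
        _ ≤ (j / 2) * (j / 2) ^ k := Nat.mul_le_mul_right _ h3
        _ = (j / 2) ^ (k + 1) := by ring
    simp only [height] at h1 h2 ⊢
    split_ifs
    exacts [hj.trans h1, hj.trans h2]
  · rintro x (hx | hx)
    · have := hA hx
      refine frequently_atTop.2 fun N => ?_
      obtain ⟨n, hn, hxn⟩ := frequently_atTop.1 this N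
      exact ⟨2 * n, by omega, by simpa using hxn⟩
    · have := hB hx
      refine frequently_atTop.2 fun N => ?_
      obtain ⟨n, hn, hxn⟩ := frequently_atTop.1 this N
      refine ⟨2 * n + 1, by omega, ?_⟩
      simpa [show (2 * n + 1) / 2 = n by omega, Nat.add_mod] using hxn

/-- The sequence running infinitely often through all finite binary sequences (the second component
of `j` codes the sequence), the `j`-th one followed by `h (j ^ j)` zeros. -/
def padded (h : ℕ → ℕ) (j : ℕ) : List Bool :=
  (Encodable.decode (α := List Bool) j.unpair.2).getD [] ++ List.replicate (h (j ^ j)) false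

lemma padded_pair (h : ℕ → ℕ) (n : ℕ) (u : List Bool) :
    padded h (Nat.pair n (Encodable.encode u)) = u ++ List.replicate
      (h (Nat.pair n (Encodable.encode u) ^ Nat.pair n (Encodable.encode u))) false := by
  simp [padded]

/-- The comeager member `[padded h]_∞` of `𝓘_h`. -/
def denseSet (h : ℕ → ℕ) : Set Cantor := infCylinder (padded h)

lemma denseSet_mem_yorioka {h : ℕ → ℕ} (hh : Monotone h) : denseSet h ∈ yorioka h := by
  refine ⟨_, fun k => ?_, subset_rfl⟩
  filter_upwards [eventually_ge_atTop k, eventually_ge_atTop 1] with j h1 h2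
  have : h (j ^ k) ≤ h (j ^ j) := hh (Nat.pow_le_pow_right h2 h1)
  simp only [height, padded, List.length_append, List.length_replicate]
  omega

/-- A bound on the lengths of those terms of `padded h` whose index has first component `n` and
which extend a finite sequence of length at most `2 n + 1`. -/
noncomputable def growth (h : ℕ → ℕ) (n : ℕ) : ℕ :=
  (List.finite_length_le Bool (2 * n + 1)).toFinset.sup fun u =>
    (padded h (Nat.pair n (Encodable.encode u))).length

lemma length_padded_le_growth (h : ℕ → ℕ) {n : ℕ} {u : List Bool} (hu : u.length ≤ 2 * n + 1) :
    (padded h (Nat.pair n (Encodable.encode u))).length ≤ growth h n :=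
  Finset.le_sup (f := fun u => (padded h (Nat.pair n (Encodable.encode u))).length)
    ((Set.Finite.mem_toFinset _).2 hu)

/-! ### Avoiding a member of a Yorioka ideal -/

/-- The conditions for avoiding `τ i`, `i ≥ i₀`: pairs of a finite binary sequence `s` and a bound
`m` such that `s` is incompatible with `τ i` for `i₀ ≤ i < m`, and the `τ i` with `i ≥ m` are so
long that they can still be diagonalized against one after the other. -/
def IsCondition (τ : ℕ → List Bool) (i₀ : ℕ) (p : List Bool × ℕ) : Prop :=
  i₀ ≤ p.2 ∧ (∀ i, i₀ ≤ i → i < p.2 → Disjoint (cylinder p.1) (cylinder (τ i))) ∧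
    ∀ i, p.2 ≤ i → p.1.length + (i - p.2) + 1 ≤ (τ i).length

/-- Density: past every index `N`, a condition extends to some term of `padded h`. -/
lemma IsCondition.exists_padded {τ : ℕ → List Bool} {i₀ : ℕ} {f h : ℕ → ℕ} (hf : StrictMono f)
    (hτ : ∀ i, i₀ ≤ i → f i ≤ (τ i).length) (hfh : ∃ᶠ n in atTop, growth h n ≤ f n)
    {p : List Bool × ℕ} (hp : IsCondition τ i₀ p) (N : ℕ) :
    ∃ j m, N ≤ j ∧ N ≤ m ∧ N ≤ (padded h j).length ∧ p.1 <+: padded h j ∧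
      IsCondition τ i₀ (padded h j, m) := by
  obtain ⟨s, m⟩ := p
  obtain ⟨hm, hdisj, hlong⟩ := hp
  dsimp only at hm hdisj hlong ⊢
  obtain ⟨n, hn, hgn⟩ := frequently_atTop.1 hfh (N + m + s.length)
  obtain ⟨u, hsu, hul, hu⟩ := exists_prefix_disjoint τ s (n := n) hlong
  have hlen := length_padded_le_growth h (n := n) (u := u) (by omega)
  have hpre : u <+: padded h (Nat.pair n (Encodable.encode u)) := by
    rw [padded_pair]
    exact List.prefix_append _ _
  have hle := hpre.length_le
  have hj : n ≤ Nat.pair n (Encodable.encode u) := Nat.left_le_pair _ _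
  refine ⟨_, n + 1, by omega, by omega, by omega, hsu.trans hpre, by dsimp only; omega, ?_, ?_⟩
  · intro i h1 h2
    rcases lt_or_ge i m with him | him
    · exact (hdisj i h1 him).mono_left (cylinder_subset_of_prefix (hsu.trans hpre))
    · exact (hu i him (Nat.lt_succ_iff.1 h2)).mono_left (cylinder_subset_of_prefix hpre)
  · intro i hi
    dsimp only at hi ⊢
    have h1 := hτ i (by omega)
    have h2 := hf.add_le_nat (i - n) n
    rw [show i - n + n = i by omega] at h2
    omega

lemma iInter_denseSet_notMem_yorioka {f : ℕ → ℕ} (hf : StrictMono f) {G : Set (ℕ → ℕ)}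
    (hne : G.Nonempty) (hG : #G < cov meagerIdeal)
    (hfG : ∀ h ∈ G, ∃ᶠ n in atTop, growth h n ≤ f n) : (⋂ h ∈ G, denseSet h) ∉ yorioka f := by
  rintro ⟨τ, hτ, hsub⟩
  obtain ⟨i₁, hi₁⟩ := eventually_atTop.1 (hτ 1)
  simp only [pow_one, height] at hi₁
  set i₀ := i₁ + 1 with hi₀
  have hτ' : ∀ i, i₀ ≤ i → f i ≤ (τ i).length := fun i hi => hi₁ i (by omega)
  let S := {p : List Bool × ℕ // IsCondition τ i₀ p}
  let s₀ : S := ⟨([], i₀), le_rfl, fun i h1 h2 => absurd h2 h1.not_gt, fun i hi => by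
    have h1 := hτ' i hi
    have h2 := hf.id_le i
    simp only [List.length_nil, id] at h2 hi ⊢
    omega⟩
  obtain ⟨s, hs, hgen⟩ := exists_generic (fun p q : S => p.1.1 <+: q.1.1)
    (fun p => List.prefix_rfl) s₀ hG
    (fun h N => {q : S | ∃ j, N ≤ j ∧ N ≤ q.1.2 ∧ N ≤ (padded h.1 j).length ∧
      q.1.1 = padded h.1 j})
    (fun h N p => by
      obtain ⟨j, m, h1, h2, h3, h4, h5⟩ := p.2.exists_padded hf hτ' (hfG h h.2) N
      exact ⟨⟨_, h5⟩, ⟨j, h1, h2, h3, rfl⟩, h4⟩)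
  obtain ⟨h₀, hh₀⟩ := hne
  obtain ⟨x, hx⟩ := exists_mem_cylinder hs fun N => by
    obtain ⟨j, k, -, -, h3, h4⟩ := hgen ⟨h₀, hh₀⟩ N
    exact ⟨j, by rwa [h4]⟩
  have hxG : x ∈ ⋂ h ∈ G, denseSet h := by
    refine Set.mem_iInter₂.2 fun h hh => frequently_atTop.2 fun N => ?_
    obtain ⟨j, k, h1, -, -, h4⟩ := hgen ⟨h, hh⟩ N
    exact ⟨k, h1, by simpa only [← h4] using hx j⟩
  obtain ⟨i, hi, hxi⟩ := frequently_atTop.1 (hsub hxG) i₀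
  obtain ⟨j, k, -, h2, -⟩ := hgen ⟨h₀, hh₀⟩ (i + 1)
  exact Set.disjoint_left.1 ((s j).2.2.1 i hi h2) (hx j) hxi

/-! ### The dominating number -/

lemma EvLE.trans {x y z : ℕ → ℕ} (h1 : EvLE x y) (h2 : EvLE y z) : EvLE x z := by
  filter_upwards [h1, h2] with n a b using a.trans b

lemma exists_isDominating_mk_eq : ∃ D : Set (ℕ → ℕ), IsDominating D ∧ #D = dominatingNumber :=
  csInf_mem (s := {κ | ∃ D : Set (ℕ → ℕ), IsDominating D ∧ #D = κ})
    ⟨_, Set.univ, fun x => ⟨x, trivial, Eventually.of_forall fun _ => le_rfl⟩, rfl⟩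

lemma not_isDominating_of_mk_lt {G : Set (ℕ → ℕ)} (hG : #G < dominatingNumber) :
    ¬ IsDominating G := fun h => hG.not_ge (csInf_le' ⟨G, h, rfl⟩)

lemma isDominating_increasing : IsDominating Increasing := fun x =>
  ⟨fun n => ∑ i ∈ Finset.range (n + 1), (x i + 1),
    strictMono_nat_of_lt_succ fun n => by rw [Finset.sum_range_succ _ (n + 1)]; omega,
    Eventually.of_forall fun n => by
      simp only
      rw [Finset.sum_range_succ]
      omega⟩

lemma aleph0_le_dominatingNumber : ℵ₀ ≤ dominatingNumber := by
  obtain ⟨D, hD, hc⟩ := exists_isDominating_mk_eq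
  by_contra! hlt
  have hfin : D.Finite := lt_aleph0_iff_set_finite.1 (hc ▸ hlt)
  obtain ⟨y, hy, hle⟩ := hD fun n => ∑ y ∈ hfin.toFinset, y n + 1
  obtain ⟨n, hn⟩ := Eventually.exists hle
  dsimp only at hn
  have : y n ≤ ∑ y ∈ hfin.toFinset, y n :=
    Finset.single_le_sum (f := fun y : ℕ → ℕ => y n) (fun _ _ => Nat.zero_le _)
      (hfin.mem_toFinset.2 hy)
  omega

lemma exists_mem_not_evLE {D : Set (ℕ → ℕ)} (hD : IsDominating D) {G : Set (ℕ → ℕ)}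
    (hG : #G < dominatingNumber) (y : ℕ → ℕ) :
    ∃ f ∈ D, EvLE y f ∧ ∀ h ∈ G, ∃ᶠ n in atTop, growth h n ≤ f n := by
  obtain ⟨z, hz⟩ : ∃ z, ∀ h ∈ G, ¬ EvLE z (growth h) := by
    have := not_isDominating_of_mk_lt (mk_image_le.trans_lt hG : #(growth '' G) < _)
    simpa [IsDominating] using this
  obtain ⟨f, hfD, hf⟩ := hD fun n => max (y n) (z n)
  refine ⟨f, hfD, EvLE.trans (Eventually.of_forall fun n => le_max_left _ _) hf, fun h hh => ?_⟩
  have hzf : EvLE z f := EvLE.trans (Eventually.of_forall fun n => le_max_right _ _) hf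
  by_contra hcon
  refine hz h hh (hzf.trans ?_)
  filter_upwards [not_frequently.1 hcon] with n hn using (not_le.1 hn).le

lemma exists_isDominatingSeq_iInter_notMem (hcov : cov meagerIdeal = dominatingNumber)
    {D : Set (ℕ → ℕ)} (hDI : D ⊆ Increasing) (hD : IsDominating D) :
    ∃ f : Set.Iio dominatingNumber.ord → ℕ → ℕ, (∀ α, f α ∈ D) ∧
      IsDominatingSeq dominatingNumber.ord f ∧
      ∀ α, (⋂ ξ : Set.Iio α, denseSet (f ξ)) ∉ yorioka (f α) := by
  obtain ⟨E, hE, hEc⟩ := exists_isDominating_mk_eq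
  obtain ⟨y⟩ : Nonempty (Set.Iio dominatingNumber.ord ≃ E) := by
    refine lift_mk_eq'.1 ?_
    simp [hEc]
  -- The constant function `0` keeps the family of earlier functions nonempty at `α = 0`.
  have key : ∀ (y : ℕ → ℕ) (G : Set (ℕ → ℕ)), ∃ f ∈ D, #G < dominatingNumber →
      EvLE y f ∧ ∀ h ∈ insert 0 G, ∃ᶠ n in atTop, growth h n ≤ f n := fun y G => by
    by_cases hG : #G < dominatingNumber
    · obtain ⟨f, h1, h2⟩ := exists_mem_not_evLE hD (G := insert 0 G)
        (mk_insert_le.trans_lt (add_lt_of_lt aleph0_le_dominatingNumber hG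
          (one_lt_aleph0.trans_le aleph0_le_dominatingNumber))) y
      exact ⟨f, h1, fun _ => h2⟩
    · obtain ⟨f, h1, -⟩ := hD y
      exact ⟨f, h1, fun h => absurd h hG⟩
  choose φ hφD hφ using key
  let f : Set.Iio dominatingNumber.ord → ℕ → ℕ :=
    (wellFounded_lt (α := Set.Iio dominatingNumber.ord)).fix fun α g =>
      φ (y α) (Set.range fun ξ : Set.Iio α => g ξ.1 ξ.2)
  have hf : ∀ α, f α = φ (y α) (Set.range fun ξ : Set.Iio α => f ξ) := fun α =>
    WellFounded.fix_eq _ _ _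
  have hcard : ∀ α : Set.Iio dominatingNumber.ord,
      #(Set.range fun ξ : Set.Iio α => f ξ) < dominatingNumber := fun α => by
    have hinj : Function.Injective
        fun ξ : Set.Iio α => (⟨ξ.1.1, ξ.2⟩ : Set.Iio (α : Ordinal.{0})) := fun a b hab =>
      Subtype.ext (Subtype.ext (congrArg (fun o : Set.Iio (α : Ordinal.{0}) => o.1) hab))
    have h1 : #(Set.Iio α) ≤ #(Set.Iio (α : Ordinal.{0})) := mk_le_of_injective hinj
    have h2 : lift.{1} #(Set.range fun ξ : Set.Iio α => f ξ) ≤ lift.{0} #(Set.Iio α) :=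
      mk_range_le_lift
    rw [mk_Iio_ordinal] at h1
    rw [lift_uzero] at h2
    exact (lift_le.1 (h2.trans h1)).trans_lt (lt_ord.1 α.2)
  have hfD : ∀ α, f α ∈ D := fun α => by rw [hf]; exact hφD _ _
  refine ⟨f, hfD, ⟨fun α => hDI (hfD α), fun x => ?_⟩, fun α hα => ?_⟩
  · obtain ⟨z, hz, hxz⟩ := hE x
    refine ⟨f (y.symm ⟨z, hz⟩), ⟨_, rfl⟩, hxz.trans ?_⟩
    have := (hφ (y (y.symm ⟨z, hz⟩)) _ (hcard (y.symm ⟨z, hz⟩))).1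
    rw [← hf, y.apply_symm_apply] at this
    exact this
  · refine iInter_denseSet_notMem_yorioka (hDI (hfD α))
      (G := insert 0 (Set.range fun ξ : Set.Iio α => f ξ)) (Set.insert_nonempty _ _) ?_ ?_
      (yorioka_mono ?_ hα)
    · rw [hcov]
      exact mk_insert_le.trans_lt (add_lt_of_lt aleph0_le_dominatingNumber (hcard α)
        (one_lt_aleph0.trans_le aleph0_le_dominatingNumber))
    · have := (hφ (y α) _ (hcard α)).2
      rwa [← hf] at this
    · exact Set.subset_iInter fun ξ => Set.biInter_subset_of_mem (Or.inr ⟨ξ, rfl⟩)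

/-! ### Dominating systems -/

lemma exists_cofinal_family {I : Type*} (hI : Cardinal.lift supcof ≤ #I) {f : ℕ → ℕ}
    (hf : f ∈ Increasing) : ∃ C : I → Set Cantor, (∀ i, C i ∈ yorioka f) ∧
      ∀ B ∈ yorioka f, ∃ i, B ⊆ C i := by
  obtain ⟨F, hF, hcof, hFc⟩ := csInf_mem
    (s := {κ | ∃ F : Set (Set Cantor), F ⊆ yorioka f ∧ (∀ A ∈ yorioka f, ∃ B ∈ F, A ⊆ B) ∧ #F = κ})
    ⟨_, yorioka f, subset_rfl, fun A hA => ⟨A, hA, subset_rfl⟩, rfl⟩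
  have hle : #F ≤ supcof :=
    hFc.trans_le (le_ciSup (f := fun f : Increasing => cof (yorioka f)) bddAbove_of_small ⟨f, hf⟩)
  obtain ⟨A₀, hA₀, -⟩ := hcof _ (denseSet_mem_yorioka (StrictMono.monotone hf))
  have : Nonempty F := ⟨⟨A₀, hA₀⟩⟩
  have hle' : Cardinal.lift #F ≤ Cardinal.lift #I := by
    rw [Cardinal.lift_uzero #I]
    exact (Cardinal.lift_le.2 hle).trans hI
  obtain ⟨c⟩ := Cardinal.lift_mk_le'.1 hle'
  refine ⟨fun i => (Function.invFun c i : F), fun i => hF (Function.invFun c i : F).2, fun B hB => ?_⟩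
  obtain ⟨A, hA, hBA⟩ := hcof B hB
  exact ⟨c ⟨A, hA⟩, by
    simpa only [Function.leftInverse_invFun c.injective ⟨A, hA⟩] using hBA⟩

lemma exists_isDominatingSystem (hcov : cov meagerIdeal = dominatingNumber)
    {D : Set (ℕ → ℕ)} (hDI : D ⊆ Increasing) (hD : IsDominating D) {I : Type*}
    (hI : Cardinal.lift supcof ≤ #I) :
    ∃ (f : Set.Iio dominatingNumber.ord → ℕ → ℕ)
      (A : Set.Iio dominatingNumber.ord → I → Set Cantor),
      (∀ α, f α ∈ D) ∧ IsDominatingSystem dominatingNumber.ord f A := by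
  obtain ⟨f, hfD, hdom, hnot⟩ := exists_isDominatingSeq_iInter_notMem hcov hDI hD
  choose C hC hcof using fun α => exists_cofinal_family hI (hDI (hfD α))
  have hmono : ∀ α, Monotone (f α) := fun α => StrictMono.monotone (hDI (hfD α))
  refine ⟨f, fun α i => C α i ∪ denseSet (f α), hfD, hdom,
    fun α i => union_mem_yorioka (hmono α) (hC α i) (denseSet_mem_yorioka (hmono α)),
    fun α B hB => ?_, fun α z hz => hnot α (yorioka_mono ?_ hz)⟩
  · obtain ⟨i, hi⟩ := hcof α B hB
    exact ⟨i, hi.trans Set.subset_union_left⟩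
  · exact Set.iInter_mono fun ξ => Set.subset_union_right

lemma IsDominatingSystem.dS {I : Type*} {δ : Ordinal.{0}} {f : Set.Iio δ → ℕ → ℕ}
    {A : Set.Iio δ → I → Set Cantor} (h : IsDominatingSystem δ f A) : DS δ := by
  have hne : ∀ α, ∃ _ : I, True := fun α => by
    have hmem := denseSet_mem_yorioka (StrictMono.monotone (h.dominating.1 α))
    obtain ⟨i, -⟩ := h.cofinal α _ hmem
    exact ⟨i, trivial⟩
  choose i _ using hne
  refine ⟨f, fun α => A α (i α), h.dominating, fun α => h.mem α _, fun α hα => ?_⟩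
  refine h.inter_notMem α (fun ξ => i ξ) ?_
  rwa [Set.biInter_eq_iInter] at hα

end DomSys

theorem lemma4p17 (h : DomSys.cov DomSys.meagerIdeal = DomSys.dominatingNumber) :
    DomSys.DS DomSys.dominatingNumber.ord ∧
    ∀ (D : Set (ℕ → ℕ)), D ⊆ DomSys.Increasing → DomSys.IsDominating D →
    ∀ (I : Type*), Cardinal.lift DomSys.supcof ≤ Cardinal.mk I →
      ∃ (f : Set.Iio DomSys.dominatingNumber.ord → ℕ → ℕ)
        (A : Set.Iio DomSys.dominatingNumber.ord → I → Set DomSys.Cantor),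
        (∀ α, f α ∈ D) ∧ DomSys.IsDominatingSystem DomSys.dominatingNumber.ord f A := by
  refine ⟨?_, fun D hDI hD I hI => DomSys.exists_isDominatingSystem h hDI hD hI⟩
  obtain ⟨f, A, -, hfA⟩ := DomSys.exists_isDominatingSystem h subset_rfl
    DomSys.isDominating_increasing (I := Quotient.out DomSys.supcof) (by simp)
  exact hfA.dS
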